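/- There are universal constants $C>0$ and $p\in\mathbb N$ such that the following holds. Let $n,N\ge 1$ and $m\ge 0$ be integers, let $A,K,B$ be real matrices of sizes $n\times n$, $m\times n$, $n\times m$, let $Q$ ($n\times n$) and $R$ ($m\times m$) be positive definite, $\gamma\in(0,1)$, $\eta=\gamma/(1-\gamma)$, and suppose that the closed-loop matrix $L=A+BK$ has spectral radius less than one. Let $W_0,W_1,\dots$ be i.i.d. $\mathcal N(0,I_n)$ random vectors, and consider the LQR trajectory under the policy $u=Kx$: $X_0=0$, $X_{k+1}=AX_k+BKX_k+W_k$. Let $\mathrm{svec}$ be the map from symmetric $n\times n$ matrices to $\mathbb R^{n(n+1)/2}$ that lists the entries on and above the diagonal with the off-diagonal entries multiplied by $\sqrt2$ (so that it preserves inner products), and put $\phi(x)=\mathrm{svec}(xx^\top+\eta I)$. Let $P_\pi$ be the unique solution of $(\gamma^{1/2}L)^\top P_\pi(\gamma^{1/2}L)-P_\pi+(Q+K^\top RK)=0$, let $v_\pi=\mathrm{svec}(P_\pi)$, and let $P_N=\sum_{t=0}^{N-1}L^t(L^t)^\top$ be the covariance of $X_N$. Norms of vectors are Euclidean and norms of matrices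 are operator norms. Then for every $\delta\in(0,1)$, with probability at least $1-\delta$, $$\Big\|\sum_{k=1}^{N}\phi(X_k)\big(\phi(X_{k+1})-\mathbb E[\phi(X_{k+1})\mid X_k]\big)^\top v_\pi\Big\|\le C\,\|v_\pi\|\sqrt N\,\big(\operatorname{Tr}P_N+\eta\sqrt n\big)\,\max\{1,\|LP_N^{1/2}\|\}\,\big(1+\log N+\log n+\log(1/\delta)\big)^p .$$ Moreover, if $L\neq 0$, then for every $\delta\in(0,1)$, with probability at least $1-\delta$, $$\Big\|\sum_{k=1}^{N}\phi(X_k)\big(\phi(X_{k+1})-\mathbb E[\phi(X_{k+1})\mid X_k]\big)^\top v_\pi\Big\|\le \frac{C}{\min\{1,\|L\|\}}\,\|v_\pi\|\sqrt N\,\big(\operatorname{Tr}P_N+\eta\sqrt n\big)\,\|LP_N^{1/2}\|\,\big(1+\log N+\log n+\log(1/\delta)\big)^p .$$ -/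

import Mathlib

open MeasureTheory ProbabilityTheory

noncomputable section

/-- Euclidean space `ℝⁿ` with the Euclidean norm and inner product. -/
abbrev Vec (n : ℕ) := EuclideanSpace ℝ (Fin n)

/-- Index set of the entries on and above the diagonal; it has `n (n + 1) / 2` elements. -/
abbrev UpperIdx (n : ℕ) := {p : Fin n × Fin n // p.1 ≤ p.2}

/-- The symmetric vectorization `svec`: entries on and above the diagonal, with the off-diagonal
entries multiplied by `√2`. -/
def svec {n : ℕ} (M : Matrix (Fin n) (Fin n) ℝ) : EuclideanSpace ℝ (UpperIdx n) :=
  WithLp.toLp 2 fun p => if p.1.1 = p.1.2 then M p.1.1 p.1.2 else √2 * M p.1.1 p.1.2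

/-- `svec` preserves inner products of symmetric matrices. -/
theorem inner_svec {n : ℕ} {M₁ M₂ : Matrix (Fin n) (Fin n) ℝ} (h₁ : M₁.IsSymm) (h₂ : M₂.IsSymm) :
    inner ℝ (svec M₁) (svec M₂) = ∑ i, ∑ j, M₁ i j * M₂ i j := by
  have hL : inner ℝ (svec M₁) (svec M₂) =
      ∑ p : UpperIdx n, if p.1.1 = p.1.2 then M₁ p.1.1 p.1.2 * M₂ p.1.1 p.1.2
        else 2 * (M₁ p.1.1 p.1.2 * M₂ p.1.1 p.1.2) := by
    rw [PiLp.inner_apply]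
    refine Finset.sum_congr rfl fun p _ => ?_
    have h2 : √(2 : ℝ) * √2 = 2 := Real.mul_self_sqrt (by norm_num)
    simp only [svec, RCLike.inner_apply, conj_trivial]
    split_ifs
    · ring
    · linear_combination (M₁ p.1.1 p.1.2 * M₂ p.1.1 p.1.2) * h2
  have hS : ∑ p : UpperIdx n, (if p.1.1 = p.1.2 then M₁ p.1.1 p.1.2 * M₂ p.1.1 p.1.2
        else 2 * (M₁ p.1.1 p.1.2 * M₂ p.1.1 p.1.2)) =
      ∑ i, ∑ j, if i ≤ j then (if i = j then M₁ i j * M₂ i j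
        else 2 * (M₁ i j * M₂ i j)) else 0 := by
    rw [← Fintype.sum_prod_type', ← Finset.sum_filter]
    exact (Finset.sum_subtype (Finset.univ.filter fun p : Fin n × Fin n => p.1 ≤ p.2) (by simp)
      (fun p : Fin n × Fin n => if p.1 = p.2 then M₁ p.1 p.2 * M₂ p.1 p.2
        else 2 * (M₁ p.1 p.2 * M₂ p.1 p.2))).symm
  rw [hL, hS]
  have hT : ∑ i, ∑ j, (if i < j then M₁ i j * M₂ i j else 0) =
      ∑ i, ∑ j, (if j < i then M₁ i j * M₂ i j else 0) := by
    rw [Finset.sum_comm]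
    simp only [h₁.apply, h₂.apply]
  have e₁ : ∀ i j : Fin n, (if i ≤ j then (if i = j then M₁ i j * M₂ i j
        else 2 * (M₁ i j * M₂ i j)) else 0) =
      M₁ i j * M₂ i j + (if i < j then M₁ i j * M₂ i j else 0) -
        (if j < i then M₁ i j * M₂ i j else 0) := by
    intro i j
    rcases lt_trichotomy i j with h | h | h
    · simp [h, h.le, h.ne, h.le.not_gt]; ring
    · simp [h]
    · simp [h, h.not_ge, h.le.not_gt]
  simp only [e₁, Finset.sum_add_distrib, Finset.sum_sub_distrib, hT]
  ring

/-- Operator (spectral) norm of a square real matrix. -/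
def opNorm {n : ℕ} (M : Matrix (Fin n) (Fin n) ℝ) : ℝ :=
  ‖Matrix.toEuclideanCLM (𝕜 := ℝ) M‖

/-- A real square matrix is stable if its spectral radius, computed over `ℂ`, is less than one. -/
def IsStableMatrix {n : ℕ} (M : Matrix (Fin n) (Fin n) ℝ) : Prop :=
  spectralRadius ℂ (M.map (algebraMap ℝ ℂ)) < 1

/-- `P_N = ∑_{t < N} Lᵗ (Lᵗ)ᵀ`, the covariance of the state at time `N` started from zero. -/
def stateCov {n : ℕ} (L : Matrix (Fin n) (Fin n) ℝ) (N : ℕ) : Matrix (Fin n) (Fin n) ℝ :=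
  ∑ t ∈ Finset.range N, L ^ t * (L ^ t).transpose

open scoped MatrixOrder in
/-- The positive semidefinite square root of a positive semidefinite matrix. -/
def psdSqrt {n : ℕ} (P : Matrix (Fin n) (Fin n) ℝ) : Matrix (Fin n) (Fin n) ℝ :=
  CFC.sqrt P

/-- `η = γ / (1 - γ)`. -/
def discountRatio (γ : ℝ) : ℝ := γ / (1 - γ)

/-- The feature map `φ(x) = svec (x xᵀ + η I)`. -/
def feature {n : ℕ} (η : ℝ) (x : Vec n) : EuclideanSpace ℝ (UpperIdx n) :=
  svec (Matrix.vecMulVec x x + η • (1 : Matrix (Fin n) (Fin n) ℝ))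

/-- The trajectory `X₀ = 0`, `X_{k+1} = A X_k + B U_k + W_k` under the linear policy
`U_k = K X_k`. -/
def lqrState {n m : ℕ} {Ω : Type*} (A : Matrix (Fin n) (Fin n) ℝ) (B : Matrix (Fin n) (Fin m) ℝ)
    (K : Matrix (Fin m) (Fin n) ℝ) (W : ℕ → Ω → Vec n) : ℕ → Ω → Vec n
  | 0 => fun _ => 0
  | k + 1 => fun ω =>
      Matrix.toEuclideanLin A (lqrState A B K W k ω) +
        Matrix.toEuclideanLin B (Matrix.toEuclideanLin K (lqrState A B K W k ω)) + W k ω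

/-- `P` solves the discounted Lyapunov equation
`(γ^{1/2} L)ᵀ P (γ^{1/2} L) - P + (Q + Kᵀ R K) = 0` with `L = A + B K`. For stable `L` and
`γ ∈ (0, 1)` it has exactly one solution, the matrix `P_π` of the value function. -/
def IsValueMatrix {n m : ℕ} (A : Matrix (Fin n) (Fin n) ℝ) (B : Matrix (Fin n) (Fin m) ℝ)
    (K : Matrix (Fin m) (Fin n) ℝ) (Q : Matrix (Fin n) (Fin n) ℝ) (R : Matrix (Fin m) (Fin m) ℝ)
    (γ : ℝ) (P : Matrix (Fin n) (Fin n) ℝ) : Prop :=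
  (√γ • (A + B * K)).transpose * P * (√γ • (A + B * K)) - P + (Q + K.transpose * R * K) = 0

/-- `∑_{k=1}^N φ(X_k) (φ(X_{k+1}) - 𝔼[φ(X_{k+1}) | X_k])ᵀ v`. -/
def martingaleTerm {n : ℕ} {Ω : Type*} [MeasurableSpace Ω] (μ : Measure Ω) (η : ℝ)
    (X : ℕ → Ω → Vec n) (v : EuclideanSpace ℝ (UpperIdx n)) (N : ℕ) (ω : Ω) :
    EuclideanSpace ℝ (UpperIdx n) :=
  ∑ k ∈ Finset.Icc 1 N,
    inner ℝ
        (feature η (X (k + 1) ω) -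
          (μ[fun ω' => feature η (X (k + 1) ω') |
            MeasurableSpace.comap (X k) inferInstance]) ω)
        v • feature η (X k ω)

end

/-! ### Exponential moments of Gaussian quadratic forms -/

/-! Since `svec` reads only the upper triangle, the value matrix may be replaced by a symmetric `S`
with the same `svec`. Write `X_{k+1} = L X_k + W_k`. The martingale difference paired with `svec S`
is then `⟨W_k, S W_k⟩ - tr S + 2⟨S L X_k, W_k⟩` almost surely (`inner_feature_sub_condExp`). Each
coordinate of the sum is thus a martingale whose increments are Gaussian quadratic polynomials with
coefficients depending on `X_k`.

These coefficients are unbounded, so they are truncated: coordinate `p` of the feature at a level `M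
p`, and `S L X_k` at a level `V`. Diagonalising `S` bounds the exponential moment of one increment,
uniformly in the frozen state; independence multiplies these bounds over time, and Chernoff gives an
exponential tail at scale `M p * V * √N` (`measure_abs_quadratic_sum_ge`).

With high probability no truncation is active, because `⟨c, X_k⟩` has a Gaussian tail of variance at
most `⟨c, P_N c⟩` (`measure_abs_inner_state_ge`). Taking `c = e_i` controls the features and
produces `Tr P_N + η√n`; taking `c = Lᵀ S e_i` controls `S L X_k` and produces `‖L P_N^{1/2}‖`. The
maximum with `1` pays for the pure noise term `⟨W, S W⟩`. A union bound costs only logarithms.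

The second bound follows from the first: `P_N ≥ I` gives `‖L‖ ≤ ‖L P_N^{1/2}‖`, which absorbs the
maximum (`max_one_opNorm_le`). -/

theorem inv_one_sub_two_mul_le_exp {a : ℝ} (ha : |a| ≤ 1 / 4) :
    1 / (1 - 2 * a) ≤ Real.exp (2 * a + 8 * a ^ 2) := by
  obtain ⟨h1, h2⟩ := abs_le.1 ha
  have h3 : 0 < 1 - 2 * a := by linarith
  rw [div_le_iff₀ h3]
  -- By `1 + y ≤ exp y` it suffices that `(1 - 2a)(1 + 2a + 8a²) = 1 + 4a²(1 - 4a) ≥ 1`.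
  have h4 := Real.add_one_le_exp (2 * a + 8 * a ^ 2)
  nlinarith [mul_nonneg (sq_nonneg a) (by linarith : 0 ≤ 1 - 4 * a),
    mul_le_mul_of_nonneg_right h4 h3.le]

/-- Completing the square turns the tilted density into a constant `M` times the density of
`N(b/(1-2a), 1/(1-2a))`. In `M`, the first-order part of `(1-2a)^{-1/2}` cancels the centring factor
`exp(-a)`, leaving an exponent quadratic in `a` and `b`. -/
theorem lintegral_exp_quadratic_gaussianReal {a : ℝ} (ha : |a| ≤ 1 / 4) (b : ℝ) :
    ∫⁻ x, ENNReal.ofReal (Real.exp (a * (x ^ 2 - 1) + b * x)) ∂(gaussianReal 0 1) ≤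
      ENNReal.ofReal (Real.exp (4 * a ^ 2 + b ^ 2)) := by
  obtain ⟨h1, h2⟩ := abs_le.1 ha
  have hd : 0 < 1 - 2 * a := by linarith
  set v : NNReal := ⟨1 / (1 - 2 * a), by positivity⟩ with hv
  have hvc : (v : ℝ) = 1 / (1 - 2 * a) := rfl
  have hv0 : v ≠ 0 := by
    intro h
    have : (v : ℝ) = 0 := by simp [h]
    rw [hvc] at this
    have : 0 < 1 / (1 - 2 * a) := by positivity
    linarith
  set M : ℝ := √v * Real.exp (-a + b ^ 2 / (2 * (1 - 2 * a))) with hM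
  have key : ∀ x : ℝ, gaussianPDFReal 0 1 x * Real.exp (a * (x ^ 2 - 1) + b * x) =
      M * gaussianPDFReal (b / (1 - 2 * a)) v x := by
    intro x
    have hs : √(v : ℝ) ≠ 0 := by
      rw [hvc]; positivity
    have hs2 : √(2 * Real.pi) ≠ 0 := by positivity
    simp only [gaussianPDFReal, hM, NNReal.coe_one, mul_one, sub_zero]
    rw [Real.sqrt_mul (by positivity) (v : ℝ), mul_inv]
    have : (√(2 * Real.pi))⁻¹ * Real.exp (-x ^ 2 / 2) * Real.exp (a * (x ^ 2 - 1) + b * x) =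
        (√(2 * Real.pi))⁻¹ * (Real.exp (-a + b ^ 2 / (2 * (1 - 2 * a))) *
          Real.exp (-(x - b / (1 - 2 * a)) ^ 2 / (2 * v))) := by
      rw [mul_assoc, ← Real.exp_add, ← Real.exp_add]
      congr 2
      rw [hvc]
      field_simp
      ring
    rw [this]
    field_simp
  rw [gaussianReal_of_var_ne_zero _ one_ne_zero, lintegral_withDensity_eq_lintegral_mul _
    (measurable_gaussianPDF 0 1) (by fun_prop)]
  have hM0 : 0 ≤ M := by positivity
  calc ∫⁻ x, (gaussianPDF 0 1 * fun x => ENNReal.ofReal (Real.exp (a * (x ^ 2 - 1) + b * x))) x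
      = ∫⁻ x, ENNReal.ofReal M * ENNReal.ofReal (gaussianPDFReal (b / (1 - 2 * a)) v x) := by
        refine lintegral_congr fun x => ?_
        rw [Pi.mul_apply, gaussianPDF, ← ENNReal.ofReal_mul (gaussianPDFReal_nonneg _ _ _), key,
          ENNReal.ofReal_mul hM0]
    _ = ENNReal.ofReal M := by
        rw [lintegral_const_mul _ (by fun_prop), lintegral_gaussianPDFReal_eq_one _ hv0, mul_one]
    _ ≤ ENNReal.ofReal (Real.exp (4 * a ^ 2 + b ^ 2)) := by
        refine ENNReal.ofReal_le_ofReal ?_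
        have e1 : √(v : ℝ) ≤ Real.exp (a + 4 * a ^ 2) := by
          rw [hvc, Real.sqrt_le_left (Real.exp_pos _).le, ← Real.exp_nat_mul]
          refine (inv_one_sub_two_mul_le_exp ha).trans (Real.exp_le_exp.2 (le_of_eq ?_))
          push_cast; ring
        have e2 : b ^ 2 / (2 * (1 - 2 * a)) ≤ b ^ 2 :=
          div_le_self (sq_nonneg b) (by linarith)
        calc M ≤ Real.exp (a + 4 * a ^ 2) * Real.exp (-a + b ^ 2 / (2 * (1 - 2 * a))) := by
              rw [hM]; gcongr
          _ = Real.exp (4 * a ^ 2 + b ^ 2 / (2 * (1 - 2 * a))) := by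
              rw [← Real.exp_add]; ring_nf
          _ ≤ _ := by gcongr

theorem lintegral_prod_pi {ι : Type*} [Fintype ι] {ν : ι → Measure ℝ}
    [∀ i, IsProbabilityMeasure (ν i)] {f : ι → ℝ → ENNReal} (hf : ∀ i, Measurable (f i)) :
    ∫⁻ x, ∏ i, f i (x i) ∂(Measure.pi ν) = ∏ i, ∫⁻ x, f i x ∂(ν i) := by
  have hind : iIndepFun (fun i (x : ι → ℝ) => f i (x i)) (Measure.pi ν) :=
    iIndepFun_pi (X := fun i x => f i x) fun i => (hf i).aemeasurable
  rw [lintegral_prod_eq_prod_lintegral_of_indepFun Finset.univ _ hind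
    (fun i => (hf i).comp (measurable_pi_apply i))]
  refine Finset.prod_congr rfl fun i _ => ?_
  exact (measurePreserving_eval ν i).lintegral_comp (hf i)

/-- Exponential moment of a quadratic polynomial of a standard Gaussian vector. -/
theorem lintegral_exp_quadratic_stdGaussian {n : ℕ} {ι : Type*} [Fintype ι]
    (b : OrthonormalBasis ι ℝ (Vec n)) {c : ι → ℝ} (hc : ∀ i, |c i| ≤ 1 / 4) (u : Vec n) :
    ∫⁻ w, ENNReal.ofReal (Real.exp (∑ i, c i * (inner ℝ (b i) w ^ 2 - 1) + inner ℝ u w))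
        ∂(stdGaussian (Vec n)) ≤
      ENNReal.ofReal (Real.exp (4 * ∑ i, c i ^ 2 + ‖u‖ ^ 2)) := by
  rw [stdGaussian_eq_map_pi_orthonormalBasis b, lintegral_map (by fun_prop) (by fun_prop)]
  have h1 : ∀ x : ι → ℝ, ENNReal.ofReal (Real.exp (∑ i, c i *
      (inner ℝ (b i) (∑ j, x j • b j) ^ 2 - 1) + inner ℝ u (∑ j, x j • b j))) =
      ∏ i, ENNReal.ofReal (Real.exp (c i * (x i ^ 2 - 1) + inner ℝ u (b i) * x i)) := by
    intro x
    rw [← ENNReal.ofReal_prod_of_nonneg (fun i _ => (Real.exp_pos _).le), ← Real.exp_sum,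
      Finset.sum_add_distrib]
    simp only [b.orthonormal.inner_right_fintype, inner_sum, real_inner_smul_right]
    simp only [mul_comm]
  simp only [h1]
  rw [lintegral_prod_pi
    (f := fun i y => ENNReal.ofReal (Real.exp (c i * (y ^ 2 - 1) + inner ℝ u (b i) * y)))
    (fun i => by fun_prop)]
  calc _ ≤ ∏ i, ENNReal.ofReal (Real.exp (4 * c i ^ 2 + (inner ℝ u (b i)) ^ 2)) :=
        Finset.prod_le_prod' fun i _ => lintegral_exp_quadratic_gaussianReal (hc i) _
    _ = _ := by
        rw [← ENNReal.ofReal_prod_of_nonneg (fun i _ => (Real.exp_pos _).le), ← Real.exp_sum,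
          Finset.sum_add_distrib, ← Finset.mul_sum, ← b.sum_sq_inner_left u]

/-! ### Matrices acting on Euclidean space -/

/-- The sum of the squares of the entries. -/
noncomputable def frobSq {n : ℕ} (S : Matrix (Fin n) (Fin n) ℝ) : ℝ := ∑ i, ∑ j, S i j ^ 2

/-- The operator on Euclidean space defined by a square matrix. -/
noncomputable abbrev euclOp {n : ℕ} (M : Matrix (Fin n) (Fin n) ℝ) : Vec n →L[ℝ] Vec n :=
  Matrix.toEuclideanCLM (𝕜 := ℝ) M

theorem euclOp_transpose {n : ℕ} (M : Matrix (Fin n) (Fin n) ℝ) (x y : Vec n) :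
    inner ℝ (euclOp M.transpose x) y = inner ℝ x (euclOp M y) := by
  rw [real_inner_comm, Matrix.inner_toEuclideanCLM, Matrix.inner_toEuclideanCLM, Matrix.dotProduct_mulVec,
    Matrix.vecMul_transpose, dotProduct_comm]

theorem euclOp_mul {n : ℕ} (M M' : Matrix (Fin n) (Fin n) ℝ) (x : Vec n) :
    euclOp (M * M') x = euclOp M (euclOp M' x) := by
  simp [euclOp, map_mul]

/-- The Frobenius norm does not depend on the orthonormal basis. The eigenbasis gives the sum of
squared eigenvalues; the standard basis gives `∑ ‖S e_i‖²`, used to bound `S L X_k` without a factor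
of the dimension. -/
theorem sum_norm_sq_euclOp {n : ℕ} {ι : Type*} [Fintype ι] {S : Matrix (Fin n) (Fin n) ℝ}
    (hS : S.IsSymm) (b : OrthonormalBasis ι ℝ (Vec n)) :
    ∑ i, ‖euclOp S (b i)‖ ^ 2 = frobSq S := by
  have h1 : ∀ i, ‖euclOp S (b i)‖ ^ 2 =
      ∑ j, (inner ℝ (b i) (euclOp S (EuclideanSpace.basisFun (Fin n) ℝ j))) ^ 2 := by
    intro i
    rw [← (EuclideanSpace.basisFun (Fin n) ℝ).sum_sq_inner_left]
    simp_rw [← euclOp_transpose, hS.eq]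
  simp_rw [h1]
  rw [Finset.sum_comm]
  simp_rw [b.sum_sq_inner_right]
  refine Finset.sum_congr rfl fun j _ => ?_
  rw [EuclideanSpace.real_norm_sq_eq]
  refine Finset.sum_congr rfl fun i _ => ?_
  rw [← hS.apply]
  simp [Matrix.ofLp_toEuclideanCLM, EuclideanSpace.basisFun_apply]

/-- Exponential moment of the centred quadratic form of a symmetric matrix plus a linear form. -/
theorem lintegral_exp_centered_quadratic {n : ℕ} {S : Matrix (Fin n) (Fin n) ℝ} (hS : S.IsSymm)
    {θ : ℝ} (hθ : θ ^ 2 * frobSq S ≤ 1 / 16) (u : Vec n) :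
    ∫⁻ w, ENNReal.ofReal (Real.exp (θ * (inner ℝ w (euclOp S w) - S.trace) + inner ℝ u w))
        ∂(stdGaussian (Vec n)) ≤
      ENNReal.ofReal (Real.exp (4 * (θ ^ 2 * frobSq S) + ‖u‖ ^ 2)) := by
  have hH : S.IsHermitian := by
    rw [Matrix.IsHermitian, Matrix.conjTranspose_eq_transpose_of_trivial, hS.eq]
  set b := hH.eigenvectorBasis
  have hb : ∀ i, euclOp S (b i) = hH.eigenvalues i • b i := by
    intro i
    ext j
    have := congrFun (hH.mulVec_eigenvectorBasis i) j
    simpa [Matrix.ofLp_toEuclideanCLM] using this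
  have hsum : ∑ i, hH.eigenvalues i ^ 2 = frobSq S := by
    rw [← sum_norm_sq_euclOp hS b]
    refine Finset.sum_congr rfl fun i _ => ?_
    rw [hb, norm_smul, b.orthonormal.norm_eq_one]
    simp
  have htr : S.trace = ∑ i, hH.eigenvalues i := by simpa using hH.trace_eq_sum_eigenvalues
  have hquad : ∀ w : Vec n, inner ℝ w (euclOp S w) =
      ∑ i, hH.eigenvalues i * inner ℝ (b i) w ^ 2 := by
    intro w
    rw [← b.sum_inner_mul_inner]
    refine Finset.sum_congr rfl fun i _ => ?_
    rw [← euclOp_transpose, hS.eq, hb, real_inner_smul_left, real_inner_comm]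
    ring
  -- A single squared eigenvalue is at most their sum `frobSq S`, so `(θ λ_i)² ≤ 1/16`.
  have hc : ∀ i, |θ * hH.eigenvalues i| ≤ 1 / 4 := by
    intro i
    refine abs_le_of_sq_le_sq (le_trans ?_ (hθ.trans (by norm_num))) (by norm_num)
    rw [mul_pow, ← hsum]
    gcongr
    exact Finset.single_le_sum (f := fun i => hH.eigenvalues i ^ 2) (fun _ _ => sq_nonneg _)
      (Finset.mem_univ i)
  have := lintegral_exp_quadratic_stdGaussian b hc u
  convert! this using 6 with w
  · rw [hquad, htr, ← Finset.sum_sub_distrib, Finset.mul_sum]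
    exact Finset.sum_congr rfl fun i _ => by ring
  · rw [← hsum, Finset.mul_sum]
    exact Finset.sum_congr rfl fun i _ => by ring

/-! ### Random recursions driven by independent noise -/

section Recursion

/-- The state at time `k` depends on the noise before time `k` only; this yields both its
measurability and its independence of `W k`. -/
theorem exists_measurable_of_recursion {Ω E F : Type*} [MeasurableSpace E] [MeasurableSpace F]
    {Y : ℕ → Ω → E} {W : ℕ → Ω → F} {f : ℕ → E × F → E} (hf : ∀ k, Measurable (f k)) {y₀ : E}
    (h0 : ∀ ω, Y 0 ω = y₀) (hs : ∀ k ω, Y (k + 1) ω = f k (Y k ω, W k ω)) (k : ℕ) :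
    ∃ g : (Finset.range k → F) → E, Measurable g ∧ ∀ ω, Y k ω = g fun i => W i ω := by
  induction k with
  | zero => exact ⟨fun _ => y₀, measurable_const, h0⟩
  | succ k ih =>
    obtain ⟨g, hg, hY⟩ := ih
    refine ⟨fun x => f k (g fun i => x ⟨i, ?_⟩, x ⟨k, by simp⟩), ?_, fun ω => ?_⟩
    · have := Finset.mem_range.1 i.2
      simp only [Finset.mem_range]
      omega
    · refine (hf k).comp ((hg.comp (measurable_pi_lambda _ fun i => ?_)).prodMk ?_)
      · exact measurable_pi_apply _
      · exact measurable_pi_apply _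
    · rw [hs, hY]

variable {Ω E F : Type*} [MeasurableSpace Ω] [MeasurableSpace E] [MeasurableSpace F]

theorem measurable_of_recursion {Y : ℕ → Ω → E} {W : ℕ → Ω → F} {f : ℕ → E × F → E}
    (hf : ∀ k, Measurable (f k)) {y₀ : E} (h0 : ∀ ω, Y 0 ω = y₀)
    (hs : ∀ k ω, Y (k + 1) ω = f k (Y k ω, W k ω)) (hW : ∀ k, Measurable (W k)) (k : ℕ) :
    Measurable (Y k) := by
  obtain ⟨g, hg, hY⟩ := exists_measurable_of_recursion hf h0 hs k
  rw [funext hY]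
  exact hg.comp (measurable_pi_lambda _ fun i => hW i)

theorem indepFun_of_recursion {μ : Measure Ω} {Y : ℕ → Ω → E} {W : ℕ → Ω → F}
    {f : ℕ → E × F → E} (hf : ∀ k, Measurable (f k)) {y₀ : E} (h0 : ∀ ω, Y 0 ω = y₀)
    (hs : ∀ k ω, Y (k + 1) ω = f k (Y k ω, W k ω)) (hW : ∀ k, Measurable (W k))
    (hind : iIndepFun W μ) (k : ℕ) : IndepFun (Y k) (W k) μ := by
  obtain ⟨g, hg, hY⟩ := exists_measurable_of_recursion hf h0 hs k
  have h1 := hind.indepFun_finset (Finset.range k) {k} (by simp) hW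
  have h2 := h1.comp hg
    (measurable_pi_apply (⟨k, Finset.mem_singleton_self k⟩ : ({k} : Finset ℕ)))
  convert! h2 using 1
  exact funext hY

/-- Fubini in place of conditioning: freeze `Z`, integrate out the fresh noise with a bound uniform
in the frozen value. In the applications `G` carries the past and `H` the next increment. -/
theorem lintegral_mul_le_of_indepFun {μ : Measure Ω} [IsProbabilityMeasure μ] {Z : Ω → E}
    {V : Ω → F} (hZ : Measurable Z) (hV : Measurable V) (hind : IndepFun Z V μ)
    {G : E → ENNReal} (hG : Measurable G) {H : E × F → ENNReal} (hH : Measurable H) {c : ENNReal}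
    (hc : ∀ z, ∫⁻ w, H (z, w) ∂(μ.map V) ≤ c) :
    ∫⁻ ω, G (Z ω) * H (Z ω, V ω) ∂μ ≤ c * ∫⁻ ω, G (Z ω) ∂μ := by
  have hmap := (indepFun_iff_map_prod_eq_prod_map_map hZ.aemeasurable hV.aemeasurable).1 hind
  have := Measure.isProbabilityMeasure_map (μ := μ) hV.aemeasurable
  calc ∫⁻ ω, G (Z ω) * H (Z ω, V ω) ∂μ
      = ∫⁻ p, G p.1 * H p ∂(μ.map fun ω => (Z ω, V ω)) := by
        rw [lintegral_map (by fun_prop) (hZ.prodMk hV)]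
    _ = ∫⁻ z, ∫⁻ w, G z * H (z, w) ∂(μ.map V) ∂(μ.map Z) := by
        rw [hmap, lintegral_prod _ (by fun_prop)]
    _ ≤ ∫⁻ z, c * G z ∂(μ.map Z) := by
        refine lintegral_mono fun z => ?_
        rw [lintegral_const_mul _ (by fun_prop), mul_comm]
        exact mul_le_mul_left (hc z) _
    _ = _ := by rw [lintegral_const_mul _ hG, lintegral_map hG hZ]

theorem lintegral_exp_sum_le {μ : Measure Ω} [IsProbabilityMeasure μ] {X : ℕ → Ω → E}
    {W : ℕ → Ω → F} {f : E × F → E} (hf : Measurable f) {x₀ : E} (h0 : ∀ ω, X 0 ω = x₀)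
    (hs : ∀ k ω, X (k + 1) ω = f (X k ω, W k ω)) (hW : ∀ k, Measurable (W k))
    (hind : iIndepFun W μ) {q : ℕ → E × F → ℝ} (hq : ∀ k, Measurable (q k)) {a : ℝ}
    (ha : ∀ k x, ∫⁻ w, ENNReal.ofReal (Real.exp (q k (x, w))) ∂(μ.map (W k)) ≤
      ENNReal.ofReal (Real.exp a)) (k : ℕ) :
    ∫⁻ ω, ENNReal.ofReal (Real.exp (∑ i ∈ Finset.range k, q i (X i ω, W i ω))) ∂μ ≤
      ENNReal.ofReal (Real.exp (k * a)) := by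
  induction k with
  | zero => simp
  | succ k ih =>
    -- The state paired with the running sum is again a recursion driven by `W`, hence independent
    -- of `W k`.
    let Y : ℕ → Ω → E × ℝ := fun k ω => (X k ω, ∑ i ∈ Finset.range k, q i (X i ω, W i ω))
    let F' : ℕ → (E × ℝ) × F → E × ℝ := fun k p => (f (p.1.1, p.2), p.1.2 + q k (p.1.1, p.2))
    have hF' : ∀ k, Measurable (F' k) := fun k => by
      have := hq k
      fun_prop
    have hY0 : ∀ ω, Y 0 ω = (x₀, 0) := fun ω => by simp [Y, h0]
    have hYs : ∀ k ω, Y (k + 1) ω = F' k (Y k ω, W k ω) := fun k ω => by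
      simp [Y, F', hs, Finset.sum_range_succ]
    have hm := measurable_of_recursion hF' hY0 hYs hW k
    have hi := indepFun_of_recursion hF' hY0 hYs hW hind k
    have hqk := hq k
    have := lintegral_mul_le_of_indepFun hm (hW k) hi
      (G := fun y => ENNReal.ofReal (Real.exp y.2)) (by fun_prop)
      (H := fun p => ENNReal.ofReal (Real.exp (q k (p.1.1, p.2)))) (by fun_prop)
      (fun z => ha k z.1)
    calc _ = ∫⁻ ω, ENNReal.ofReal (Real.exp (Y k ω).2) *
          ENNReal.ofReal (Real.exp (q k ((Y k ω).1, W k ω))) ∂μ := by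
          refine lintegral_congr fun ω => ?_
          rw [← ENNReal.ofReal_mul (Real.exp_pos _).le, ← Real.exp_add, Finset.sum_range_succ]
      _ ≤ ENNReal.ofReal (Real.exp a) * ENNReal.ofReal (Real.exp (k * a)) :=
          this.trans (mul_le_mul_right ih _)
      _ = _ := by
          rw [← ENNReal.ofReal_mul (Real.exp_pos _).le, ← Real.exp_add]
          congr 2
          push_cast
          ring

end Recursion

/-- Chernoff bound. -/
theorem measure_ge_le_of_lintegral_exp {Ω : Type*} [MeasurableSpace Ω] {μ : Measure Ω}
    {f : Ω → ℝ} (hf : Measurable f) {a : ℝ}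
    (h : ∫⁻ ω, ENNReal.ofReal (Real.exp (f ω)) ∂μ ≤ ENNReal.ofReal (Real.exp a)) (t : ℝ) :
    μ {ω | t ≤ f ω} ≤ ENNReal.ofReal (Real.exp (a - t)) := by
  have h1 := mul_meas_ge_le_lintegral (μ := μ)
    (f := fun ω => ENNReal.ofReal (Real.exp (f ω))) (by fun_prop) (ENNReal.ofReal (Real.exp t))
  have h2 : {ω | ENNReal.ofReal (Real.exp t) ≤ ENNReal.ofReal (Real.exp (f ω))} =
      {ω | t ≤ f ω} := by
    ext ω
    simp [ENNReal.ofReal_le_ofReal_iff (Real.exp_pos _).le]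
  rw [h2] at h1
  have h3 : μ {ω | t ≤ f ω} = ENNReal.ofReal (Real.exp (-t)) *
      (ENNReal.ofReal (Real.exp t) * μ {ω | t ≤ f ω}) := by
    rw [← mul_assoc, ← ENNReal.ofReal_mul (Real.exp_pos _).le, ← Real.exp_add]
    simp
  rw [h3]
  calc _ ≤ ENNReal.ofReal (Real.exp (-t)) * ENNReal.ofReal (Real.exp a) :=
        mul_le_mul_right (h1.trans h) _
    _ = _ := by
        rw [← ENNReal.ofReal_mul (Real.exp_pos _).le, ← Real.exp_add]
        congr 2; ring

theorem measure_abs_ge_le_of_lintegral_exp {Ω : Type*} [MeasurableSpace Ω] {μ : Measure Ω}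
    {f : Ω → ℝ} (hf : Measurable f) {a : ℝ}
    (h : ∀ s : ℝ, s ^ 2 = 1 →
      ∫⁻ ω, ENNReal.ofReal (Real.exp (s * f ω)) ∂μ ≤ ENNReal.ofReal (Real.exp a)) (t : ℝ) :
    μ {ω | t ≤ |f ω|} ≤ ENNReal.ofReal (2 * Real.exp (a - t)) := by
  have h1 := measure_ge_le_of_lintegral_exp (by fun_prop) (h 1 (by norm_num)) t
  have h2 := measure_ge_le_of_lintegral_exp (by fun_prop) (h (-1) (by norm_num)) t
  calc μ {ω | t ≤ |f ω|} ≤ μ ({ω | t ≤ 1 * f ω} ∪ {ω | t ≤ -1 * f ω}) := by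
        refine measure_mono fun ω hω => ?_
        simpa [le_abs] using hω
    _ ≤ _ := measure_union_le _ _
    _ ≤ ENNReal.ofReal (Real.exp (a - t)) + ENNReal.ofReal (Real.exp (a - t)) :=
        add_le_add h1 h2
    _ = _ := by
        rw [← ENNReal.ofReal_add (Real.exp_pos _).le (Real.exp_pos _).le, two_mul]

/-! ### The linear state recursion -/

theorem lqrState_succ {n m : ℕ} {Ω : Type*} (A : Matrix (Fin n) (Fin n) ℝ)
    (B : Matrix (Fin n) (Fin m) ℝ) (K : Matrix (Fin m) (Fin n) ℝ) (W : ℕ → Ω → Vec n)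
    (k : ℕ) (ω : Ω) :
    lqrState A B K W (k + 1) ω = euclOp (A + B * K) (lqrState A B K W k ω) + W k ω := by
  have h : ∀ x : Vec n, euclOp (A + B * K) x =
      Matrix.toEuclideanLin A x + Matrix.toEuclideanLin B (Matrix.toEuclideanLin K x) := by
    intro x
    ext i
    simp [euclOp, Matrix.ofLp_toEuclideanCLM, Matrix.toLpLin_apply]
  rw [h]
  rfl

/-- `⟨c, P_N c⟩ = ∑_{t < N} ‖(Lᵀ)ᵗ c‖²`. -/
theorem inner_stateCov {n : ℕ} (L : Matrix (Fin n) (Fin n) ℝ) (N : ℕ) (c : Vec n) :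
    inner ℝ c (euclOp (stateCov L N) c) =
      ∑ t ∈ Finset.range N, ‖euclOp (L.transpose ^ t) c‖ ^ 2 := by
  rw [stateCov, euclOp, map_sum, sum_apply, inner_sum]
  refine Finset.sum_congr rfl fun t _ => ?_
  have := euclOp_mul (L ^ t) (L ^ t).transpose c
  rw [euclOp] at this
  rw [this, ← euclOp_transpose, real_inner_self_eq_norm_sq, Matrix.transpose_pow]

theorem inner_stateCov_mono {n : ℕ} (L : Matrix (Fin n) (Fin n) ℝ) {k N : ℕ} (h : k ≤ N)
    (c : Vec n) :
    inner ℝ c (euclOp (stateCov L k) c) ≤ inner ℝ c (euclOp (stateCov L N) c) := by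
  rw [inner_stateCov, inner_stateCov]
  exact Finset.sum_le_sum_of_subset_of_nonneg (Finset.range_mono h) fun _ _ _ => sq_nonneg _

/-- The term `t = 0` of `stateCov` is the identity, so `P_N ≥ I` as soon as `N ≥ 1`. -/
theorem norm_sq_le_inner_stateCov {n : ℕ} (L : Matrix (Fin n) (Fin n) ℝ) {N : ℕ} (h : 1 ≤ N)
    (c : Vec n) : ‖c‖ ^ 2 ≤ inner ℝ c (euclOp (stateCov L N) c) := by
  refine le_trans (le_of_eq ?_) (inner_stateCov_mono L h c)
  simp [inner_stateCov, euclOp]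

section State

variable {n : ℕ} {Ω : Type*} [MeasurableSpace Ω] {μ : Measure Ω} [IsProbabilityMeasure μ]
  {L : Matrix (Fin n) (Fin n) ℝ} {X W : ℕ → Ω → Vec n}

/-- Induction over all `c` at once, since `⟨c, L x + w⟩ = ⟨Lᵀ c, x⟩ + ⟨c, w⟩` replaces `c` by `Lᵀ
c`. The exponent is twice the exact Gaussian one, as the noise factor comes from the quadratic bound
with `S = 0`. -/
theorem lintegral_exp_inner_state (h0 : ∀ ω, X 0 ω = 0)
    (hs : ∀ k ω, X (k + 1) ω = euclOp L (X k ω) + W k ω) (hW : ∀ k, Measurable (W k))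
    (hind : iIndepFun W μ) (hlaw : ∀ k, μ.map (W k) = stdGaussian (Vec n)) (k : ℕ) (c : Vec n) :
    ∫⁻ ω, ENNReal.ofReal (Real.exp (inner ℝ c (X k ω))) ∂μ ≤
      ENNReal.ofReal (Real.exp (inner ℝ c (euclOp (stateCov L k) c))) := by
  induction k generalizing c with
  | zero => simp [h0, stateCov, euclOp]
  | succ k ih =>
    have hf : ∀ _ : ℕ, Measurable fun p : Vec n × Vec n => euclOp L p.1 + p.2 := by
      intro _; fun_prop
    have hm := measurable_of_recursion hf h0 hs hW k
    have hi := indepFun_of_recursion hf h0 hs hW hind k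
    have h1 := lintegral_mul_le_of_indepFun hm (hW k) hi
      (G := fun x => ENNReal.ofReal (Real.exp (inner ℝ (euclOp L.transpose c) x))) (by fun_prop)
      (H := fun p => ENNReal.ofReal (Real.exp (inner ℝ c p.2))) (by fun_prop)
      (c := ENNReal.ofReal (Real.exp (‖c‖ ^ 2))) (fun z => by
        have := lintegral_exp_centered_quadratic (S := (0 : Matrix (Fin n) (Fin n) ℝ))
          (by simp [Matrix.IsSymm]) (θ := 0) (by norm_num) c
        simpa [hlaw] using this)
    calc _ = ∫⁻ ω, ENNReal.ofReal (Real.exp (inner ℝ (euclOp L.transpose c) (X k ω))) *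
          ENNReal.ofReal (Real.exp (inner ℝ c (W k ω))) ∂μ := by
          refine lintegral_congr fun ω => ?_
          rw [← ENNReal.ofReal_mul (Real.exp_pos _).le, ← Real.exp_add, hs, inner_add_right,
            euclOp_transpose]
      _ ≤ _ := h1.trans (mul_le_mul_right (ih _) _)
      _ = _ := by
          rw [← ENNReal.ofReal_mul (Real.exp_pos _).le, ← Real.exp_add, inner_stateCov,
            inner_stateCov, Finset.sum_range_succ']
          congr 2
          simp_rw [pow_succ, euclOp_mul]
          simp [euclOp, add_comm]

/-- Gaussian tail bound for linear functionals of the state. -/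
theorem measure_abs_inner_state_ge (h0 : ∀ ω, X 0 ω = 0)
    (hs : ∀ k ω, X (k + 1) ω = euclOp L (X k ω) + W k ω) (hW : ∀ k, Measurable (W k))
    (hind : iIndepFun W μ) (hlaw : ∀ k, μ.map (W k) = stdGaussian (Vec n)) {k N : ℕ}
    (hN : 1 ≤ N) (hk : k ≤ N) (c : Vec n) {τ : ℝ} (hτ0 : 0 ≤ τ)
    (hτ : inner ℝ c (euclOp (stateCov L N) c) ≤ τ ^ 2) {r : ℝ} (hr : 0 ≤ r) :
    μ {ω | τ * r < |inner ℝ c (X k ω)|} ≤ ENNReal.ofReal (2 * Real.exp (-(r ^ 2 / 4))) := by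
  have hf : ∀ _ : ℕ, Measurable fun p : Vec n × Vec n => euclOp L p.1 + p.2 := by
    intro _; fun_prop
  have hm := measurable_of_recursion hf h0 hs hW k
  -- If `τ = 0`, then `P_N ≥ I` forces `c = 0` and the event, being defined by a strict inequality,
  -- is empty.
  rcases hτ0.eq_or_lt with h | h
  · have hc : c = 0 := by
      have := (norm_sq_le_inner_stateCov L hN c).trans hτ
      rw [← h] at this
      exact norm_eq_zero.1 (pow_eq_zero_iff two_ne_zero |>.1
        (le_antisymm (by simpa using this) (sq_nonneg _)))
    simp [hc, ← h]
  -- This `θ` minimises the Chernoff exponent `θ²τ² - θτr`, with minimum `-r²/4`.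
  · set θ := r / (2 * τ) with hθ
    have hθ0 : 0 ≤ θ := by positivity
    have h1 := measure_abs_ge_le_of_lintegral_exp (μ := μ)
      (f := fun ω => θ * inner ℝ c (X k ω)) (by fun_prop) (a := r ^ 2 / 4) (fun s hs' => by
        have h2 := lintegral_exp_inner_state h0 hs hW hind hlaw k ((s * θ) • c)
        simp only [real_inner_smul_left, map_smul, real_inner_smul_right, mul_assoc] at h2 ⊢
        refine h2.trans (ENNReal.ofReal_le_ofReal (Real.exp_le_exp.2 ?_))
        have h3 := (inner_stateCov_mono L hk c).trans hτ
        calc _ = s ^ 2 * θ ^ 2 * inner ℝ c (euclOp (stateCov L k) c) := by ring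
          _ ≤ 1 * θ ^ 2 * τ ^ 2 := by rw [hs']; gcongr
          _ = _ := by rw [hθ]; field_simp; ring) (r ^ 2 / 2)
    refine (measure_mono fun ω hω => ?_).trans (h1.trans (le_of_eq ?_))
    · simp only [Set.mem_ofPred_eq] at hω ⊢
      rw [abs_mul, abs_of_nonneg hθ0]
      calc r ^ 2 / 2 = θ * (τ * r) := by rw [hθ]; field_simp
        _ ≤ _ := by gcongr
    · congr 3; ring

end State

/-! ### Martingale sums with truncated coefficients -/

section TruncatedSum

variable {n : ℕ} {Ω : Type*} [MeasurableSpace Ω] {μ : Measure Ω} [IsProbabilityMeasure μ]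
  {L : Matrix (Fin n) (Fin n) ℝ} {X W : ℕ → Ω → Vec n}

/-- Exponential tail bound for sums of Gaussian quadratic martingale differences with bounded
predictable coefficients. -/
theorem measure_abs_quadratic_sum_ge (h0 : ∀ ω, X 0 ω = 0)
    (hs : ∀ k ω, X (k + 1) ω = euclOp L (X k ω) + W k ω) (hW : ∀ k, Measurable (W k))
    (hind : iIndepFun W μ) (hlaw : ∀ k, μ.map (W k) = stdGaussian (Vec n)) {N : ℕ}
    (hN : 1 ≤ N) {S : Matrix (Fin n) (Fin n) ℝ} (hS : S.IsSymm) {M V : ℝ} (hM : 0 < M)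
    (hV : 0 < V) (hSV : frobSq S ≤ V ^ 2) {g : Vec n → ℝ} (hg : Measurable g)
    (hgM : ∀ x, |g x| ≤ M) {G : Vec n → Vec n} (hG : Measurable G) (hGV : ∀ x, ‖G x‖ ≤ V)
    (t : ℝ) :
    μ {ω | 4 * M * V * √(N : ℝ) * t ≤ |∑ k ∈ Finset.Icc 1 N, g (X k ω) *
        (inner ℝ (W k ω) (euclOp S (W k ω)) - S.trace + 2 * inner ℝ (G (X k ω)) (W k ω))|} ≤
      ENNReal.ofReal (2 * Real.exp (1 - t)) := by
  have hN' : (1 : ℝ) ≤ N := by exact_mod_cast hN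
  have hsN : 0 < √(N : ℝ) := by positivity
  have hf : Measurable fun p : Vec n × Vec n => euclOp L p.1 + p.2 := by fun_prop
  have hm := measurable_of_recursion (fun _ => hf) h0 hs hW
  -- With this scale the quadratic and the linear part each add at most `4/(16N)` to the exponent of
  -- one step, hence `1/(2N)` together.
  set l : ℝ := 1 / (4 * M * V * √(N : ℝ)) with hl
  have hl0 : 0 < l := by positivity
  have hl2 : l ^ 2 * M ^ 2 * V ^ 2 = 1 / (16 * N) := by
    rw [hl, div_pow, mul_pow, Real.sq_sqrt (by positivity)]
    field_simp
    norm_num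
  have hrange : (Finset.range (N + 1)).filter (fun k => 1 ≤ k) = Finset.Icc 1 N := by
    ext k; simp; omega
  set f : Ω → ℝ := fun ω => ∑ k ∈ Finset.Icc 1 N, g (X k ω) *
        (inner ℝ (W k ω) (euclOp S (W k ω)) - S.trace + 2 * inner ℝ (G (X k ω)) (W k ω))
    with hfdef
  have hfm : Measurable f := by
    refine Finset.measurable_sum _ fun k _ => ?_
    have h1 := hm k
    have h2 := hW k
    fun_prop
  have key : ∀ s : ℝ, s ^ 2 = 1 → ∫⁻ ω, ENNReal.ofReal (Real.exp (s * (l * f ω))) ∂μ ≤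
      ENNReal.ofReal (Real.exp 1) := by
    intro s hs1
    -- The general bound sums from time `0`, so the increment there is set to zero. The `N + 1`
    -- steps cost `(N + 1)/(2N) ≤ 1`.
    let q : ℕ → Vec n × Vec n → ℝ := fun k p => if 1 ≤ k then
      (s * l * g p.1) * (inner ℝ p.2 (euclOp S p.2) - S.trace) +
        inner ℝ ((2 * (s * l * g p.1)) • G p.1) p.2 else 0
    have hq : ∀ k, Measurable (q k) := by
      intro k
      by_cases hk : 1 ≤ k
      · simp only [q, hk, if_true]; fun_prop
      · simp only [q, hk, if_false]; fun_prop
    have hbound : ∀ k x, ∫⁻ w, ENNReal.ofReal (Real.exp (q k (x, w))) ∂(μ.map (W k)) ≤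
        ENNReal.ofReal (Real.exp (1 / (2 * N))) := by
      intro k x
      rw [hlaw]
      by_cases hk : 1 ≤ k
      · simp only [q, hk, if_true]
        have hg2 : g x ^ 2 ≤ M ^ 2 := sq_le_sq' (abs_le.1 (hgM x)).1 (abs_le.1 (hgM x)).2
        have hfs : 0 ≤ frobSq S :=
          Finset.sum_nonneg fun _ _ => Finset.sum_nonneg fun _ _ => sq_nonneg _
        have hθ : (s * l * g x) ^ 2 * frobSq S ≤ 1 / (16 * N) := by
          rw [← hl2, mul_pow, mul_pow, hs1, one_mul]
          gcongr
        have hu : ‖(2 * (s * l * g x)) • G x‖ ^ 2 ≤ 4 * (1 / (16 * N)) := by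
          rw [← hl2, norm_smul, mul_pow, Real.norm_eq_abs, sq_abs]
          have : (2 * (s * l * g x)) ^ 2 = 4 * (l ^ 2 * g x ^ 2) := by
            linear_combination (4 * (l ^ 2 * g x ^ 2)) * hs1
          rw [this, mul_assoc 4]
          have := hGV x
          gcongr
        refine (lintegral_exp_centered_quadratic hS (hθ.trans ?_) _).trans
          (ENNReal.ofReal_le_ofReal (Real.exp_le_exp.2 ?_))
        · rw [div_le_div_iff₀ (by positivity) (by norm_num)]
          linarith
        · calc _ ≤ 4 * (1 / (16 * (N : ℝ))) + 4 * (1 / (16 * N)) := by gcongr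
            _ = _ := by field_simp; norm_num
      · simp only [q, hk, if_false, Real.exp_zero, ENNReal.ofReal_one, lintegral_one,
          measure_univ]
        rw [← ENNReal.ofReal_one]
        exact ENNReal.ofReal_le_ofReal (Real.one_le_exp (by positivity))
    have h1 := lintegral_exp_sum_le hf h0 hs hW hind hq hbound (N + 1)
    refine le_trans (le_of_eq (lintegral_congr fun ω => ?_)) (h1.trans
      (ENNReal.ofReal_le_ofReal (Real.exp_le_exp.2 ?_)))
    · congr 2
      simp only [hfdef, q]
      rw [← Finset.sum_filter, hrange, Finset.mul_sum, Finset.mul_sum]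
      refine Finset.sum_congr rfl fun k _ => ?_
      rw [real_inner_smul_left]
      ring
    · push_cast
      rw [mul_one_div, div_le_one (by positivity)]
      linarith
  refine (measure_mono fun ω hω => ?_).trans
    (measure_abs_ge_le_of_lintegral_exp (f := fun ω => l * f ω) (by fun_prop) key t)
  simp only [Set.mem_ofPred_eq] at hω ⊢
  rw [abs_mul, abs_of_pos hl0]
  calc t = l * (4 * M * V * √(N : ℝ) * t) := by rw [hl]; field_simp
    _ ≤ _ := by gcongr

end TruncatedSum

/-! ### The symmetric vectorization -/

theorem exists_isSymm_svec_eq {n : ℕ} (P : Matrix (Fin n) (Fin n) ℝ) :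
    ∃ S : Matrix (Fin n) (Fin n) ℝ, S.IsSymm ∧ svec P = svec S := by
  refine ⟨Matrix.of fun i j => if i ≤ j then P i j else P j i, ?_, ?_⟩
  · ext i j
    simp only [Matrix.transpose_apply, Matrix.of_apply]
    rcases lt_trichotomy i j with h | h | h
    · simp [h.le, h.not_ge]
    · simp [h]
    · simp [h.le, h.not_ge]
  · ext p
    simp [svec, p.2]

theorem frobSq_eq_norm_svec_sq {n : ℕ} {S : Matrix (Fin n) (Fin n) ℝ} (hS : S.IsSymm) :
    frobSq S = ‖svec S‖ ^ 2 := by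
  rw [← real_inner_self_eq_norm_sq, inner_svec hS hS, frobSq]
  simp_rw [sq]

theorem inner_feature {n : ℕ} {S : Matrix (Fin n) (Fin n) ℝ} (hS : S.IsSymm) (η : ℝ)
    (x : Vec n) : inner ℝ (feature η x) (svec S) = inner ℝ x (euclOp S x) + η * S.trace := by
  rw [feature, inner_svec _ hS]
  · rw [Matrix.inner_toEuclideanCLM]
    simp only [Matrix.add_apply, Matrix.vecMulVec_apply, Matrix.smul_apply, add_mul,
      Finset.sum_add_distrib, smul_eq_mul, Matrix.one_apply, dotProduct, Matrix.mulVec,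
      Finset.mul_sum, Matrix.trace, Matrix.diag]
    congr 1
    · exact Finset.sum_congr rfl fun i _ => Finset.sum_congr rfl fun j _ => by ring
    · simp
  · ext i j
    simp [Matrix.vecMulVec_apply, Matrix.one_apply, mul_comm, eq_comm]

theorem abs_feature_le {n : ℕ} {η : ℝ} (hη : 0 ≤ η) (x : Vec n) (p : UpperIdx n) :
    |feature η x p| ≤ √2 * (|x p.1.1| * |x p.1.2| + if p.1.1 = p.1.2 then η else 0) := by
  have h2 : 1 ≤ √(2 : ℝ) := Real.one_le_sqrt.2 (by norm_num)
  simp only [feature, svec, Matrix.add_apply, Matrix.vecMulVec_apply, Matrix.smul_apply,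
    Matrix.one_apply, smul_eq_mul]
  split_ifs with h
  · rw [mul_one]
    calc |x p.1.1 * x p.1.2 + η| ≤ |x p.1.1| * |x p.1.2| + η := by
          rw [← abs_mul]
          exact (abs_add_le _ _).trans (by rw [abs_of_nonneg hη])
      _ ≤ _ := le_mul_of_one_le_left (by positivity) h2
  · rw [mul_zero, add_zero, add_zero, abs_mul, abs_mul, abs_of_nonneg (Real.sqrt_nonneg 2)]

theorem continuous_feature {n : ℕ} (η : ℝ) : Continuous (feature (n := n) η) := by
  refine (PiLp.continuous_toLp 2 _).comp (continuous_pi fun p => ?_)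
  simp only [Matrix.add_apply, Matrix.vecMulVec_apply]
  split_ifs <;> fun_prop

/-! ### The conditional expectation of the feature vector -/

theorem integrable_inner_of_memLp_two {n : ℕ} {Ω : Type*} [MeasurableSpace Ω] {μ : Measure Ω}
    {f g : Ω → Vec n} (hf : MemLp f 2 μ) (hg : MemLp g 2 μ) :
    Integrable (fun ω => inner ℝ (f ω) (g ω)) μ := by
  simp only [PiLp.inner_apply]
  refine integrable_finsetSum _ fun i _ => ?_
  exact (hg.eval_piLp i).integrable_mul (hf.eval_piLp i)

theorem integrable_feature {n : ℕ} {Ω : Type*} [MeasurableSpace Ω] {μ : Measure Ω}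
    [IsProbabilityMeasure μ] {f : Ω → Vec n} (hf : MemLp f 2 μ) (η : ℝ) :
    Integrable (fun ω => feature η (f ω)) μ := by
  refine Integrable.of_eval_piLp fun p => ?_
  have h1 : Integrable (fun ω => f ω p.1.1 * f ω p.1.2) μ :=
    (hf.eval_piLp p.1.1).integrable_mul (hf.eval_piLp p.1.2)
  simp only [feature, svec, Matrix.add_apply, Matrix.vecMulVec_apply]
  split_ifs
  · exact h1.add (integrable_const _)
  · exact (h1.add (integrable_const _)).const_mul _

theorem integral_quadratic_stdGaussian {n : ℕ} (S : Matrix (Fin n) (Fin n) ℝ) :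
    ∫ w, inner ℝ w (euclOp S w) ∂(stdGaussian (Vec n)) = S.trace := by
  have hid : MemLp id 2 (stdGaussian (Vec n)) := IsGaussian.memLp_two_id
  have hinner : ∀ a b : Vec n,
      ∫ w, inner ℝ a w * inner ℝ b w ∂(stdGaussian (Vec n)) = inner ℝ a b := by
    intro a b
    have h := covarianceBilin_apply hid a b
    rw [covarianceBilin_stdGaussian] at h
    simpa [innerSL_apply_apply ℝ] using h.symm
  have hexp : ∀ w : Vec n, inner ℝ w (euclOp S w) = ∑ i,
      inner ℝ (EuclideanSpace.basisFun (Fin n) ℝ i) w *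
        inner ℝ (euclOp S.transpose (EuclideanSpace.basisFun (Fin n) ℝ i)) w := by
    intro w
    rw [← (EuclideanSpace.basisFun (Fin n) ℝ).sum_inner_mul_inner]
    simp_rw [euclOp_transpose, real_inner_comm w]
  simp_rw [hexp]
  rw [integral_finsetSum]
  · simp_rw [hinner, Matrix.trace, Matrix.diag]
    refine Finset.sum_congr rfl fun i _ => ?_
    rw [real_inner_comm, euclOp_transpose]
    simp [EuclideanSpace.basisFun_apply, EuclideanSpace.inner_single_left,
      Matrix.ofLp_toEuclideanCLM]
  · intro i _
    exact (hid.const_inner _).integrable_mul (hid.const_inner _)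

/-- Expand the quadratic form of `S` at `L Y + V`. The part in `Y` alone and the constant `η tr S`
are `m`-measurable and cancel; the cross term has conditional mean zero and the form in `V` has
conditional mean `tr S`. -/
theorem inner_feature_sub_condExp {n : ℕ} {Ω : Type*} {m m₀ : MeasurableSpace Ω}
    {μ : Measure Ω} [IsProbabilityMeasure μ] {Y Y' V : Ω → Vec n}
    {L S : Matrix (Fin n) (Fin n) ℝ} (hS : S.IsSymm) (η : ℝ) (hm : m ≤ m₀)
    (hYm : Measurable[m] Y) (hYL : MemLp Y 2 μ) (hV : Measurable V)
    (hlaw : μ.map V = stdGaussian (Vec n))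
    (hVind : Indep (MeasurableSpace.comap V inferInstance) m μ)
    (hY' : ∀ ω, Y' ω = euclOp L (Y ω) + V ω) :
    ∀ᵐ ω ∂μ, inner ℝ (feature η (Y' ω) - (μ[fun ω' => feature η (Y' ω') | m]) ω) (svec S) =
      inner ℝ (V ω) (euclOp S (V ω)) - S.trace +
        2 * inner ℝ (euclOp S (euclOp L (Y ω))) (V ω) := by
  have hid : MemLp id 2 (stdGaussian (Vec n)) := IsGaussian.memLp_two_id
  have hVL : MemLp V 2 μ := by
    rw [← hlaw] at hid
    exact (memLp_map_measure_iff aestronglyMeasurable_id hV.aemeasurable).1 hid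
  have hLY : MemLp (fun ω => euclOp L (Y ω)) 2 μ := (euclOp L).comp_memLp' hYL
  have hSLY : MemLp (fun ω => euclOp S (euclOp L (Y ω))) 2 μ := (euclOp S).comp_memLp' hLY
  have hSV : MemLp (fun ω => euclOp S (V ω)) 2 μ := (euclOp S).comp_memLp' hVL
  have hY'L : MemLp Y' 2 μ := by
    rw [funext hY']
    exact hLY.add hVL
  -- the cross term
  have hcross : μ[fun ω => inner ℝ (euclOp S (euclOp L (Y ω))) (V ω) | m] =ᵐ[μ] 0 := by
    have hV0 : μ[V | m] =ᵐ[μ] fun _ => (0 : Vec n) := by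
      have := condExp_indep_eq hV.comap_le hm (comap_measurable V).stronglyMeasurable hVind
      have h0 : ∫ ω, V ω ∂μ = 0 := by
        have := integral_map (μ := μ) hV.aemeasurable (f := fun x : Vec n => x) (by fun_prop)
        rw [← this, hlaw, integral_id_stdGaussian]
      simpa [h0] using this
    have hf : StronglyMeasurable[m] fun ω => euclOp S (euclOp L (Y ω)) := by
      refine Measurable.stronglyMeasurable ?_
      exact (euclOp S).continuous.measurable.comp ((euclOp L).continuous.measurable.comp hYm)
    have := condExp_bilin_of_stronglyMeasurable_left (m := m) (innerSL ℝ) hf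
      (g := V) (μ := μ) (integrable_inner_of_memLp_two hSLY hVL)
      (hVL.integrable (by norm_num))
    filter_upwards [this, hV0] with ω h1 h2
    refine h1.trans ?_
    rw [h2, map_zero, Pi.zero_apply]
  -- the quadratic term
  have hquad : μ[fun ω => inner ℝ (V ω) (euclOp S (V ω)) | m] =ᵐ[μ] fun _ => S.trace := by
    have hc : Measurable fun w : Vec n => inner ℝ w (euclOp S w) := by fun_prop
    have := condExp_indep_eq (f := fun ω => inner ℝ (V ω) (euclOp S (V ω))) hV.comap_le hm
      (hc.comp (comap_measurable V)).stronglyMeasurable hVind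
    have h0 : ∫ ω, inner ℝ (V ω) (euclOp S (V ω)) ∂μ = S.trace := by
      have := integral_map (μ := μ) hV.aemeasurable hc.aestronglyMeasurable
      rw [← this, hlaw, integral_quadratic_stdGaussian]
    rwa [h0] at this
  -- the term depending on `Y` only
  set h : Ω → ℝ := fun ω =>
    inner ℝ (euclOp L (Y ω)) (euclOp S (euclOp L (Y ω))) + η * S.trace with hh
  have hhint : Integrable h μ :=
    (integrable_inner_of_memLp_two hLY hSLY).add (integrable_const _)
  have hhm : μ[h | m] = h := by
    refine condExp_of_stronglyMeasurable hm ?_ hhint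
    refine Measurable.stronglyMeasurable ?_
    have hc : Measurable fun y : Vec n =>
      inner ℝ (euclOp L y) (euclOp S (euclOp L y)) + η * S.trace := by fun_prop
    exact hc.comp hYm
  have hexp : ∀ ω, inner ℝ (feature η (Y' ω)) (svec S) =
      h ω + 2 * inner ℝ (euclOp S (euclOp L (Y ω))) (V ω) +
        inner ℝ (V ω) (euclOp S (V ω)) := by
    intro ω
    have e : ∀ x y : Vec n, inner ℝ (euclOp S x) y = inner ℝ x (euclOp S y) := by
      intro x y
      rw [← euclOp_transpose, hS.eq]
    rw [inner_feature hS, hY', hh, map_add, inner_add_left, inner_add_right, inner_add_right,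
      ← e (euclOp L (Y ω)) (V ω), real_inner_comm (euclOp S (euclOp L (Y ω))) (V ω)]
    ring
  have hi1 := integrable_inner_of_memLp_two hSLY hVL
  have hi2 := integrable_inner_of_memLp_two hVL hSV
  have hT := ((innerSL ℝ (svec S)).comp_condExp_comm (m := m) (integrable_feature hY'L η))
  have hsum : μ[innerSL ℝ (svec S) ∘ (fun ω' => feature η (Y' ω')) | m] =ᵐ[μ]
      fun ω => h ω + S.trace := by
    have hfun : (innerSL ℝ (svec S) ∘ fun ω' => feature η (Y' ω')) =
        (h + (2 : ℝ) • fun ω => inner ℝ (euclOp S (euclOp L (Y ω))) (V ω)) +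
          fun ω => inner ℝ (V ω) (euclOp S (V ω)) := by
      ext ω
      simp only [Function.comp_apply, innerSL_apply_apply, Pi.add_apply, Pi.smul_apply,
        smul_eq_mul]
      rw [real_inner_comm, hexp]
    rw [hfun]
    have a1 := condExp_add (m := m) (hhint.add (hi1.smul (2 : ℝ))) hi2
    have a2 := condExp_add (m := m) hhint (hi1.smul (2 : ℝ))
    have a3 := condExp_smul (m := m) (μ := μ) (2 : ℝ)
      (fun ω => inner ℝ (euclOp S (euclOp L (Y ω))) (V ω))
    filter_upwards [a1, a2, a3, hcross, hquad] with ω b1 b2 b3 b4 b5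
    rw [b1, Pi.add_apply, b2, Pi.add_apply, b3, Pi.smul_apply, b4, b5, hhm]
    simp
  filter_upwards [hT, hsum] with ω b1 b2
  rw [b2, Function.comp_apply, innerSL_apply_apply] at b1
  rw [inner_sub_left, hexp, real_inner_comm (svec S), b1]
  ring

/-! ### Operator norm and the square root of the covariance -/

theorem opNorm_transpose {n : ℕ} (M : Matrix (Fin n) (Fin n) ℝ) :
    opNorm M.transpose = opNorm M := by
  have h : M.transpose = star M := by
    rw [Matrix.star_eq_conjTranspose, Matrix.conjTranspose_eq_transpose_of_trivial]
  rw [opNorm, opNorm, h, map_star, ContinuousLinearMap.star_eq_adjoint,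
    LinearIsometryEquiv.norm_map]

theorem stateCov_posSemidef {n : ℕ} (L : Matrix (Fin n) (Fin n) ℝ) (N : ℕ) :
    (stateCov L N).PosSemidef := by
  refine Matrix.posSemidef_sum _ fun t _ => ?_
  rw [← Matrix.conjTranspose_eq_transpose_of_trivial]
  exact Matrix.posSemidef_self_mul_conjTranspose _

open scoped MatrixOrder in
theorem psdSqrt_mul_self {n : ℕ} {M : Matrix (Fin n) (Fin n) ℝ} (hM : M.PosSemidef) :
    psdSqrt M * psdSqrt M = M := CFC.sqrt_mul_sqrt_self M hM.nonneg

open scoped MatrixOrder in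
theorem psdSqrt_transpose {n : ℕ} (M : Matrix (Fin n) (Fin n) ℝ) :
    (psdSqrt M).transpose = psdSqrt M := by
  rw [← Matrix.conjTranspose_eq_transpose_of_trivial]
  exact (Matrix.nonneg_iff_posSemidef.1 (CFC.sqrt_nonneg M)).isHermitian

/-- With `R` the square root of `P_N`, the left side equals `‖(L R)ᵀ y‖²`. It bounds the variance of
`⟨y, L X_k⟩` for `k ≤ N`. -/
theorem inner_stateCov_transpose_le {n : ℕ} (L : Matrix (Fin n) (Fin n) ℝ) (N : ℕ) (y : Vec n) :
    inner ℝ (euclOp L.transpose y) (euclOp (stateCov L N) (euclOp L.transpose y)) ≤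
      (opNorm (L * psdSqrt (stateCov L N)) * ‖y‖) ^ 2 := by
  set R := psdSqrt (stateCov L N) with hR
  have h1 : inner ℝ (euclOp L.transpose y) (euclOp (stateCov L N) (euclOp L.transpose y)) =
      ‖euclOp (L * R).transpose y‖ ^ 2 := by
    rw [← psdSqrt_mul_self (stateCov_posSemidef L N), ← hR, euclOp_mul, ← euclOp_transpose, hR,
      psdSqrt_transpose, ← hR, real_inner_self_eq_norm_sq, Matrix.transpose_mul, euclOp_mul, hR,
      psdSqrt_transpose]
  rw [h1, ← opNorm_transpose (L * R)]
  have := (euclOp (L * R).transpose).le_opNorm y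
  exact pow_le_pow_left₀ (norm_nonneg _) this 2

theorem opNorm_le_opNorm_mul_psdSqrt {n N : ℕ} (L : Matrix (Fin n) (Fin n) ℝ) (hN : 1 ≤ N) :
    opNorm L ≤ opNorm (L * psdSqrt (stateCov L N)) := by
  rw [← opNorm_transpose L]
  refine ContinuousLinearMap.opNorm_le_bound _ (norm_nonneg _) fun y => ?_
  refine abs_le_of_sq_le_sq' ?_ (by unfold opNorm; positivity) |>.2
  exact (norm_sq_le_inner_stateCov L hN _).trans (inner_stateCov_transpose_le L N y)

theorem opNorm_pos {n : ℕ} {L : Matrix (Fin n) (Fin n) ℝ} (hL : L ≠ 0) : 0 < opNorm L := by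
  refine norm_pos_iff.2 fun h => hL ?_
  exact (map_eq_zero_iff _ (Matrix.toEuclideanCLM (n := Fin n) (𝕜 := ℝ)).injective).1 h

/-- After multiplying by the minimum, the branch `1` is `min ≤ ‖L‖ ≤ ‖L P_N^{1/2}‖`, and the other
branch uses `min ≤ 1`. -/
theorem max_one_opNorm_le {n N : ℕ} {L : Matrix (Fin n) (Fin n) ℝ} (hN : 1 ≤ N) (hL : L ≠ 0) :
    max 1 (opNorm (L * psdSqrt (stateCov L N))) ≤
      opNorm (L * psdSqrt (stateCov L N)) / min 1 (opNorm L) := by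
  have h0 := opNorm_pos hL
  have h1 := opNorm_le_opNorm_mul_psdSqrt L hN
  rw [le_div_iff₀ (lt_min one_pos h0), max_mul_of_nonneg _ _ (le_min zero_le_one h0.le)]
  refine max_le ?_ (mul_le_of_le_one_right (h0.le.trans h1) (min_le_left _ _))
  rw [one_mul]
  exact (min_le_right _ _).trans h1

/-! ### Union bounds -/

theorem measure_iUnion_le_card_mul {Ω ι : Type*} [MeasurableSpace Ω] {μ : Measure Ω} [Fintype ι]
    {s : ι → Set Ω} {ε : ℝ} (h : ∀ i, μ (s i) ≤ ENNReal.ofReal ε) :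
    μ (⋃ i, s i) ≤ ENNReal.ofReal (Fintype.card ι * ε) := by
  calc μ (⋃ i, s i) ≤ ∑ i, μ (s i) := measure_iUnion_fintype_le μ s
    _ ≤ ∑ _i : ι, ENNReal.ofReal ε := Finset.sum_le_sum fun i _ => h i
    _ = _ := by
      rw [Finset.sum_const, Finset.card_univ, nsmul_eq_mul,
        ENNReal.ofReal_mul (Nat.cast_nonneg _), ENNReal.ofReal_natCast]

theorem le_measure_of_compl_le {Ω : Type*} [MeasurableSpace Ω] {μ : Measure Ω}
    [IsProbabilityMeasure μ] {s : Set Ω} {δ : ℝ} (hδ : 0 ≤ δ) (h : μ sᶜ ≤ ENNReal.ofReal δ) :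
    ENNReal.ofReal (1 - δ) ≤ μ s := by
  rw [ENNReal.ofReal_sub _ hδ, ENNReal.ofReal_one, tsub_le_iff_right]
  calc (1 : ENNReal) = μ Set.univ := measure_univ.symm
    _ ≤ μ s + μ sᶜ := measure_univ_le_add_compl s
    _ ≤ _ := by gcongr

/-- The union bound budget: `N n` events for state coordinates, `N n` for coordinates of `S L X_k`,
and at most `n²` for entries of the sum. The factor `4` in the exponent leaves `e^{-3} δ / (N n²)`
for each exponential, and `e^{-3} ≤ 1/6`. -/
theorem card_mul_exp_le {n N : ℕ} (hn : 1 ≤ n) (hN : 1 ≤ N) {δ : ℝ} (hδ : 0 < δ) (hδ1 : δ < 1) :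
    (2 * (N * n) + n * n : ℝ) *
      (2 * Real.exp (1 - 4 * (1 + Real.log N + Real.log n + Real.log (1 / δ)))) ≤ δ := by
  have hn' : (1 : ℝ) ≤ n := by exact_mod_cast hn
  have hN' : (1 : ℝ) ≤ N := by exact_mod_cast hN
  have l1 := Real.log_nonneg hn'
  have l2 := Real.log_nonneg hN'
  have l3 : Real.log δ < 0 := Real.log_neg hδ hδ1
  have h1 : Real.exp (1 - 4 * (1 + Real.log N + Real.log n + Real.log (1 / δ))) ≤
      Real.exp (-3) * (δ / (N * n ^ 2)) := by
    have : δ / (N * n ^ 2) = Real.exp (Real.log δ - Real.log N - 2 * Real.log n) := by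
      rw [Real.exp_sub, Real.exp_sub, Real.exp_log hδ, Real.exp_log (by linarith),
        two_mul, Real.exp_add, Real.exp_log (by linarith), div_div]
      ring
    rw [this, ← Real.exp_add, one_div, Real.log_inv]
    exact Real.exp_le_exp.2 (by linarith)
  have h2 : Real.exp (-3) ≤ 1 / 6 := by
    rw [Real.exp_neg, one_div]
    refine inv_anti₀ (by norm_num) ?_
    have h3 : (2 : ℝ) ≤ Real.exp 1 := by linarith [Real.add_one_le_exp (1 : ℝ)]
    calc (6 : ℝ) ≤ 2 ^ 3 := by norm_num
      _ ≤ Real.exp 1 ^ 3 := by gcongr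
      _ = Real.exp 3 := by rw [← Real.exp_nat_mul]; norm_num
  have h3 : (2 * (N * n) + n * n : ℝ) ≤ 3 * (N * n ^ 2) := by
    nlinarith [mul_nonneg (by linarith : (0 : ℝ) ≤ N) (by nlinarith : (0 : ℝ) ≤ n ^ 2 - n),
      mul_nonneg (sub_nonneg.2 hN') (sq_nonneg (n : ℝ))]
  calc _ ≤ 3 * (N * n ^ 2 : ℝ) * (2 * (1 / 6 * (δ / (N * n ^ 2)))) := by
        refine mul_le_mul h3 ?_ (by positivity) (by positivity)
        refine mul_le_mul_of_nonneg_left (h1.trans ?_) (by norm_num)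
        exact mul_le_mul_of_nonneg_right h2 (by positivity)
    _ = δ := by field_simp; norm_num

/-! ### The concentration bound -/

/-- The entry `(i, j)` of a bound for the feature vector, given the covariance diagonal `d`. -/
noncomputable def featureScale {n : ℕ} (d : Fin n → ℝ) (η : ℝ) (i j : Fin n) : ℝ :=
  √2 * (√(d i) * √(d j) + if i = j then η else 0)

theorem sum_featureScale_sq_le {n : ℕ} (hn : 1 ≤ n) {d : Fin n → ℝ} (hd : ∀ i, 0 ≤ d i) {η : ℝ}
    (hη : 0 ≤ η) :
    ∑ p : UpperIdx n, featureScale d η p.1.1 p.1.2 ^ 2 ≤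
      2 * (∑ i, d i + η * √(n : ℝ)) ^ 2 := by
  have hn' : 1 ≤ √(n : ℝ) := Real.one_le_sqrt.2 (by exact_mod_cast hn)
  have hd0 : 0 ≤ ∑ i, d i := Finset.sum_nonneg fun i _ => hd i
  have e : ∀ i j : Fin n, featureScale d η i j ^ 2 =
      2 * (d i * d j) + if i = j then 4 * (d i * η) + 2 * η ^ 2 else 0 := by
    intro i j
    rw [featureScale, mul_pow, Real.sq_sqrt (by norm_num)]
    split_ifs with h
    · subst h
      rw [Real.mul_self_sqrt (hd i)]
      ring
    · rw [add_zero, add_zero, mul_pow, Real.sq_sqrt (hd i), Real.sq_sqrt (hd j)]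
  calc ∑ p : UpperIdx n, featureScale d η p.1.1 p.1.2 ^ 2
      ≤ ∑ p : Fin n × Fin n, featureScale d η p.1 p.2 ^ 2 := by
        rw [← Finset.sum_subtype (Finset.univ.filter fun p : Fin n × Fin n => p.1 ≤ p.2)
          (by simp) (fun p : Fin n × Fin n => featureScale d η p.1 p.2 ^ 2)]
        exact Finset.sum_le_sum_of_subset_of_nonneg (Finset.filter_subset _ _)
          fun _ _ _ => sq_nonneg _
    _ = 2 * (∑ i, d i) ^ 2 + 4 * (∑ i, d i) * η + 2 * n * η ^ 2 := by
        rw [Fintype.sum_prod_type]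
        simp only [e, Finset.sum_add_distrib, Finset.sum_ite_eq, Finset.mem_univ, if_true,
          ← Finset.mul_sum, ← Finset.sum_mul, Finset.sum_const, Finset.card_univ,
          Fintype.card_fin, nsmul_eq_mul]
        ring
    -- The two sides differ only in the cross term, which gains a factor `√n ≥ 1` on the right.
    _ ≤ _ := by
        have : √(n : ℝ) ^ 2 = n := Real.sq_sqrt (Nat.cast_nonneg n)
        nlinarith [mul_nonneg (mul_nonneg hd0 hη) (sub_nonneg.2 hn')]

theorem norm_le_of_forall_abs_le {ι : Type*} [Fintype ι] {x : EuclideanSpace ℝ ι} {m : ι → ℝ}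
    {a b : ℝ} (ha : 0 ≤ a) (hb : 0 ≤ b) (h : ∀ i, |x i| ≤ a * m i) (hm : ∑ i, m i ^ 2 ≤ b ^ 2) :
    ‖x‖ ≤ a * b := by
  refine abs_le_of_sq_le_sq' ?_ (by positivity) |>.2
  rw [EuclideanSpace.real_norm_sq_eq, mul_pow]
  calc ∑ i, x i ^ 2 ≤ ∑ i, a ^ 2 * m i ^ 2 := by
        refine Finset.sum_le_sum fun i _ => ?_
        rw [← mul_pow, ← sq_abs]
        exact pow_le_pow_left₀ (abs_nonneg _) (h i) 2
    _ ≤ _ := by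
        rw [← Finset.mul_sum]
        gcongr

theorem le_measure_norm_martingaleTerm_le {n m N : ℕ} (hn : 1 ≤ n) (hN : 1 ≤ N)
    (A : Matrix (Fin n) (Fin n) ℝ) (B : Matrix (Fin n) (Fin m) ℝ)
    (K : Matrix (Fin m) (Fin n) ℝ) (P : Matrix (Fin n) (Fin n) ℝ) {η : ℝ} (hη : 0 ≤ η) {δ : ℝ}
    (hδ : 0 < δ) (hδ1 : δ < 1) {Ω : Type*} [MeasurableSpace Ω] (μ : Measure Ω)
    [IsProbabilityMeasure μ] (W : ℕ → Ω → Vec n) (hW : ∀ k, Measurable (W k))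
    (hind : iIndepFun W μ) (hlaw : ∀ k, μ.map (W k) = stdGaussian (Vec n)) :
    ENNReal.ofReal (1 - δ) ≤
        μ {ω | ‖martingaleTerm μ η (lqrState A B K W) (svec P) N ω‖ ≤
          2048 * ‖svec P‖ * √(N : ℝ) * ((stateCov (A + B * K) N).trace + η * √(n : ℝ)) *
            max 1 (opNorm ((A + B * K) * psdSqrt (stateCov (A + B * K) N))) *
            (1 + Real.log N + Real.log n + Real.log (1 / δ)) ^ 4} := by
  obtain ⟨S, hS, hPS⟩ := exists_isSymm_svec_eq P
  rw [hPS]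
  -- The truncation level `V` below must be positive; for `svec S = 0` the sum vanishes.
  by_cases hS0 : svec S = 0
  · simp only [martingaleTerm, hS0, inner_zero_right, zero_smul, Finset.sum_const_zero, norm_zero,
      mul_zero, zero_mul, le_refl, Set.ofPred_true, measure_univ]
    rw [← ENNReal.ofReal_one]
    exact ENNReal.ofReal_le_ofReal (by linarith)
  set L := A + B * K
  set X := lqrState A B K W
  have h0 : ∀ ω, X 0 ω = 0 := fun _ => rfl
  have hs : ∀ k ω, X (k + 1) ω = euclOp L (X k ω) + W k ω := lqrState_succ A B K W
  have hf : ∀ _ : ℕ, Measurable fun p : Vec n × Vec n => euclOp L p.1 + p.2 := by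
    intro _; fun_prop
  have hXm := measurable_of_recursion hf h0 hs hW
  have hXind := indepFun_of_recursion hf h0 hs hW hind
  have hXL : ∀ k, MemLp (X k) 2 μ := by
    intro k
    induction k with
    | zero =>
      rw [funext h0]
      exact memLp_const _
    | succ k ih =>
      rw [funext (hs k)]
      have hid : MemLp id 2 (stdGaussian (Vec n)) := IsGaussian.memLp_two_id
      rw [← hlaw k] at hid
      exact ((euclOp L).comp_memLp' ih).add
        ((memLp_map_measure_iff aestronglyMeasurable_id (hW k).aemeasurable).1 hid)
  set ℓ := 1 + Real.log N + Real.log n + Real.log (1 / δ)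
  have hℓ : 1 ≤ ℓ := by
    have l1 := Real.log_nonneg (by exact_mod_cast hn : (1 : ℝ) ≤ n)
    have l2 := Real.log_nonneg (by exact_mod_cast hN : (1 : ℝ) ≤ N)
    have l3 := Real.log_nonneg (by rw [le_div_iff₀ hδ]; linarith : 1 ≤ 1 / δ)
    simp only [ℓ]
    linarith
  set σ := max 1 (opNorm (L * psdSqrt (stateCov L N)))
  have hσ : 1 ≤ σ := le_max_left _ _
  have hF : 0 < ‖svec S‖ := norm_pos_iff.2 hS0
  set e : Fin n → Vec n := fun i => EuclideanSpace.basisFun (Fin n) ℝ i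
  set d : Fin n → ℝ := fun i => inner ℝ (e i) (euclOp (stateCov L N) (e i))
  have he : ∀ i (x : Vec n), inner ℝ (e i) x = x i := fun i x => by
    simp [e, EuclideanSpace.basisFun_apply, EuclideanSpace.inner_single_left]
  have hd1 : ∀ i, 1 ≤ d i := fun i => by
    have := norm_sq_le_inner_stateCov L hN (e i)
    rwa [(EuclideanSpace.basisFun (Fin n) ℝ).orthonormal.norm_eq_one i, one_pow] at this
  have hdtr : ∑ i, d i = (stateCov L N).trace := by
    simp only [d, he, Matrix.trace, Matrix.diag]
    simp [e, Matrix.ofLp_toEuclideanCLM, EuclideanSpace.basisFun_apply]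
  -- Then `r²/4 = 4ℓ² ≥ 4ℓ - 1`, so the Gaussian tails are below the same `ε` as the exponential
  -- tails at `t = 4ℓ`.
  set r := 4 * ℓ with hr
  have hr1 : 1 ≤ r := by linarith
  set V := σ * r * ‖svec S‖ with hV
  have hV0 : 0 < V := by positivity
  set ε := 2 * Real.exp (1 - 4 * ℓ) with hε
  have hrε : ENNReal.ofReal (2 * Real.exp (-(r ^ 2 / 4))) ≤ ENNReal.ofReal ε := by
    refine ENNReal.ofReal_le_ofReal (mul_le_mul_of_nonneg_left (Real.exp_le_exp.2 ?_) (by norm_num))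
    rw [hr]
    nlinarith
  -- truncated coefficients
  set M : UpperIdx n → ℝ := fun p => r ^ 2 * featureScale d η p.1.1 p.1.2 with hMdef
  have hM0 : ∀ p, 0 < M p := by
    intro p
    have h1 := Real.sqrt_pos.2 (one_pos.trans_le (hd1 p.1.1))
    have h2 := Real.sqrt_pos.2 (one_pos.trans_le (hd1 p.1.2))
    have h3 : (0 : ℝ) ≤ if p.1.1 = p.1.2 then η else 0 := by split_ifs <;> simp [hη]
    simp only [hMdef, featureScale]
    positivity
  set g : UpperIdx n → Vec n → ℝ := fun p x => if |feature η x p| ≤ M p then feature η x p else 0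
    with hgdef
  have hfm : ∀ p : UpperIdx n, Measurable fun x : Vec n => feature η x p := fun p =>
    ((PiLp.continuous_apply 2 _ p).comp (continuous_feature η)).measurable
  have hgm : ∀ p, Measurable (g p) := fun p =>
    Measurable.ite (measurableSet_le (hfm p).abs measurable_const) (hfm p) measurable_const
  have hgM : ∀ p x, |g p x| ≤ M p := by
    intro p x
    simp only [hgdef]
    split_ifs with h
    · exact h
    · simpa using (hM0 p).le
  set G : Vec n → Vec n := fun x =>
    if ‖euclOp S (euclOp L x)‖ ≤ V then euclOp S (euclOp L x) else 0 with hGdef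
  have hGm : Measurable G :=
    Measurable.ite (measurableSet_le (by fun_prop) measurable_const) (by fun_prop) measurable_const
  have hGV : ∀ x, ‖G x‖ ≤ V := by
    intro x
    simp only [hGdef]
    split_ifs with h
    · exact h
    · simpa using hV0.le
  -- the exceptional events
  set E₁ : Finset.Icc 1 N × Fin n → Set Ω := fun q => {ω | √(d q.2) * r < |X q.1 ω q.2|}
  set E₂ : Finset.Icc 1 N × Fin n → Set Ω := fun q =>
    {ω | σ * ‖euclOp S (e q.2)‖ * r < |euclOp S (euclOp L (X q.1 ω)) q.2|}
  set E₃ : UpperIdx n → Set Ω := fun p =>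
    {ω | 4 * M p * V * √(N : ℝ) * (4 * ℓ) ≤ |∑ k ∈ Finset.Icc 1 N, g p (X k ω) *
      (inner ℝ (W k ω) (euclOp S (W k ω)) - S.trace + 2 * inner ℝ (G (X k ω)) (W k ω))|}
  have hE₁ : ∀ q, μ (E₁ q) ≤ ENNReal.ofReal ε := by
    intro q
    have := measure_abs_inner_state_ge h0 hs hW hind hlaw hN (Finset.mem_Icc.1 q.1.2).2 (e q.2)
      (Real.sqrt_nonneg (d q.2)) (Real.sq_sqrt (by linarith [hd1 q.2])).ge
      (by linarith : 0 ≤ r)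
    simp only [he] at this
    exact this.trans hrε
  have hE₂ : ∀ q, μ (E₂ q) ≤ ENNReal.ofReal ε := by
    intro q
    have h1 := inner_stateCov_transpose_le L N (euclOp S (e q.2))
    have h2 := measure_abs_inner_state_ge h0 hs hW hind hlaw hN (Finset.mem_Icc.1 q.1.2).2
      (euclOp L.transpose (euclOp S (e q.2))) (τ := σ * ‖euclOp S (e q.2)‖) (by positivity)
      (h1.trans (pow_le_pow_left₀ (mul_nonneg (norm_nonneg _) (norm_nonneg _))
        (mul_le_mul_of_nonneg_right (le_max_right _ _) (norm_nonneg _)) 2))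
      (by linarith : 0 ≤ r)
    have h3 : ∀ x : Vec n, inner ℝ (euclOp L.transpose (euclOp S (e q.2))) x =
        euclOp S (euclOp L x) q.2 := by
      intro x
      rw [euclOp_transpose, ← he, ← euclOp_transpose S, hS.eq]
    simp only [h3] at h2
    exact h2.trans hrε
  have hE₃ : ∀ p, μ (E₃ p) ≤ ENNReal.ofReal ε := fun p =>
    measure_abs_quadratic_sum_ge h0 hs hW hind hlaw hN hS (hM0 p) hV0
      -- One level `V` must dominate both `‖S L X_k‖` and the Frobenius norm of `S`; the latter
      -- holds because `σ r ≥ 1`.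
      (by
        rw [frobSq_eq_norm_svec_sq hS]
        refine pow_le_pow_left₀ hF.le ?_ 2
        rw [hV]
        exact le_mul_of_one_le_left hF.le (one_le_mul_of_one_le_of_one_le hσ hr1))
      (hgm p) (hgM p) hGm hGV (4 * ℓ)
  have hcond : ∀ᵐ ω ∂μ, ∀ k, inner ℝ (feature η (X (k + 1) ω) -
        (μ[fun ω' => feature η (X (k + 1) ω') |
          MeasurableSpace.comap (X k) inferInstance]) ω) (svec S) =
      inner ℝ (W k ω) (euclOp S (W k ω)) - S.trace +
        2 * inner ℝ (euclOp S (euclOp L (X k ω))) (W k ω) :=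
    ae_all_iff.2 fun k => inner_feature_sub_condExp hS η (hXm k).comap_le
      (comap_measurable (X k)) (hXL k) (hW k) (hlaw k) (hXind k).symm (hs k)
  refine le_measure_of_compl_le hδ.le ?_
  -- Off the exceptional events no truncation is active. The inclusion is only almost sure, as the
  -- conditional expectation is identified only up to null sets.
  have hsub : {ω | ‖martingaleTerm μ η X (svec S) N ω‖ ≤
          2048 * ‖svec S‖ * √(N : ℝ) * ((stateCov L N).trace + η * √(n : ℝ)) * σ * ℓ ^ 4}ᶜ
      ≤ᵐ[μ] ((⋃ q, E₁ q) ∪ (⋃ q, E₂ q) ∪ ⋃ p, E₃ p : Set Ω) := by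
    filter_upwards [hcond] with ω hω hbad
    by_contra hgood
    refine hbad ?_
    replace hgood : ω ∉ (⋃ q, E₁ q) ∪ (⋃ q, E₂ q) ∪ ⋃ p, E₃ p := hgood
    simp only [Set.mem_union, Set.mem_iUnion, not_or, not_exists] at hgood
    obtain ⟨⟨g₁, g₂⟩, g₃⟩ := hgood
    simp only [E₁, E₂, E₃, Set.mem_ofPred_eq, not_lt, not_le] at g₁ g₂ g₃
    have hx : ∀ k ∈ Finset.Icc 1 N, ∀ i, |X k ω i| ≤ √(d i) * r := fun k hk i =>
      g₁ (⟨k, hk⟩, i)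
    have hG : ∀ k ∈ Finset.Icc 1 N, G (X k ω) = euclOp S (euclOp L (X k ω)) := by
      intro k hk
      refine if_pos ?_
      rw [hV]
      refine norm_le_of_forall_abs_le (m := fun i => ‖euclOp S (e i)‖) (by positivity) hF.le
        (fun i => ?_) ?_
      · exact (g₂ (⟨k, hk⟩, i)).trans (le_of_eq (by ring))
      · rw [← frobSq_eq_norm_svec_sq hS,
          ← sum_norm_sq_euclOp hS (EuclideanSpace.basisFun (Fin n) ℝ)]
    have hg : ∀ p, ∀ k ∈ Finset.Icc 1 N, g p (X k ω) = feature η (X k ω) p := by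
      intro p k hk
      refine if_pos ((abs_feature_le hη _ p).trans ?_)
      have h3 : (0 : ℝ) ≤ if p.1.1 = p.1.2 then η else 0 := by split_ifs <;> simp [hη]
      calc _ ≤ √2 * ((√(d p.1.1) * r) * (√(d p.1.2) * r) +
            r ^ 2 * if p.1.1 = p.1.2 then η else 0) := by
            refine mul_le_mul_of_nonneg_left (add_le_add ?_ ?_) (Real.sqrt_nonneg 2)
            · exact mul_le_mul (hx k hk _) (hx k hk _) (abs_nonneg _) (by positivity)
            · exact le_mul_of_one_le_left h3 (one_le_pow₀ hr1)
        _ = M p := by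
            simp only [hMdef, featureScale]
            ring
    have hcoord : ∀ p, |martingaleTerm μ η X (svec S) N ω p| ≤
        (4 * V * √(N : ℝ) * (4 * ℓ) * r ^ 2) * featureScale d η p.1.1 p.1.2 := by
      intro p
      have h1 : martingaleTerm μ η X (svec S) N ω p = ∑ k ∈ Finset.Icc 1 N, g p (X k ω) *
          (inner ℝ (W k ω) (euclOp S (W k ω)) - S.trace +
            2 * inner ℝ (G (X k ω)) (W k ω)) := by
        rw [martingaleTerm, WithLp.ofLp_sum, Finset.sum_apply]
        refine Finset.sum_congr rfl fun k hk => ?_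
        rw [hω k, hG k hk, hg p k hk, PiLp.smul_apply, smul_eq_mul, mul_comm]
      rw [h1]
      refine (g₃ p).le.trans (le_of_eq ?_)
      simp only [hMdef]
      ring
    have hT : 0 ≤ (stateCov L N).trace + η * √(n : ℝ) := by
      rw [← hdtr]
      have : 0 ≤ ∑ i, d i := Finset.sum_nonneg fun i _ => by linarith [hd1 i]
      positivity
    have hfinal := norm_le_of_forall_abs_le (by positivity)
      (mul_nonneg zero_le_two hT) hcoord
      ((sum_featureScale_sq_le hn (fun i => by linarith [hd1 i]) hη).trans (by
        rw [hdtr, mul_pow]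
        exact mul_le_mul_of_nonneg_right (by norm_num) (sq_nonneg _)))
    -- With `V = 4ℓσ‖svec S‖` and `r² = 16ℓ²`, the constant is `4 · 4 · 4 · 16 · 2 = 2048` and the
    -- power is `ℓ⁴`. The last factor `2` rounds up `√2` from `featureScale`.
    refine hfinal.trans (le_of_eq ?_)
    rw [hV, hr]
    ring
  have hcard : Fintype.card (UpperIdx n) ≤ n * n := by
    refine (Fintype.card_subtype_le _).trans (le_of_eq ?_)
    simp
  have hε0 : 0 ≤ ε := by positivity
  calc _ ≤ μ ((⋃ q, E₁ q) ∪ (⋃ q, E₂ q) ∪ ⋃ p, E₃ p) := measure_mono_ae hsub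
    _ ≤ μ (⋃ q, E₁ q) + μ (⋃ q, E₂ q) + μ (⋃ p, E₃ p) :=
        (measure_union_le _ _).trans (add_le_add_left (measure_union_le _ _) _)
    _ ≤ ENNReal.ofReal (Fintype.card (Finset.Icc 1 N × Fin n) * ε) +
          ENNReal.ofReal (Fintype.card (Finset.Icc 1 N × Fin n) * ε) +
          ENNReal.ofReal (Fintype.card (UpperIdx n) * ε) :=
        add_le_add (add_le_add (measure_iUnion_le_card_mul hE₁) (measure_iUnion_le_card_mul hE₂))
          (measure_iUnion_le_card_mul hE₃)
    _ ≤ ENNReal.ofReal δ := by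
        rw [← ENNReal.ofReal_add (by positivity) (by positivity),
          ← ENNReal.ofReal_add (by positivity) (by positivity)]
        refine ENNReal.ofReal_le_ofReal (le_trans ?_ (card_mul_exp_le hn hN hδ hδ1))
        have h1 : (Fintype.card (Finset.Icc 1 N × Fin n) : ℝ) = N * n := by simp
        have h2 : (Fintype.card (UpperIdx n) : ℝ) ≤ n * n := by exact_mod_cast hcard
        rw [h1, ← add_mul, ← add_mul]
        refine mul_le_mul_of_nonneg_right ?_ hε0
        linarith

theorem mainTheorem7 :
    ∃ C : ℝ, 0 < C ∧ ∃ p : ℕ,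
      ∀ (n m N : ℕ), 1 ≤ n → 1 ≤ N →
      ∀ (A : Matrix (Fin n) (Fin n) ℝ) (B : Matrix (Fin n) (Fin m) ℝ)
        (K : Matrix (Fin m) (Fin n) ℝ) (Q : Matrix (Fin n) (Fin n) ℝ)
        (R : Matrix (Fin m) (Fin m) ℝ) (γ : ℝ) (P : Matrix (Fin n) (Fin n) ℝ) (δ : ℝ),
      Q.PosDef → R.PosDef → 0 < γ → γ < 1 → IsStableMatrix (A + B * K) →
      IsValueMatrix A B K Q R γ P → 0 < δ → δ < 1 →
      ∀ (Ω : Type*) [MeasurableSpace Ω] (μ : Measure Ω) [IsProbabilityMeasure μ]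
        (W : ℕ → Ω → Vec n),
      (∀ k, Measurable (W k)) → iIndepFun W μ →
      (∀ k, μ.map (W k) = stdGaussian (Vec n)) →
      -- the bound with universal constants
      (ENNReal.ofReal (1 - δ) ≤
        μ {ω | ‖martingaleTerm μ (discountRatio γ) (lqrState A B K W) (svec P) N ω‖ ≤
          C * ‖svec P‖ * √(N : ℝ) *
            ((stateCov (A + B * K) N).trace + discountRatio γ * √(n : ℝ)) *
            max 1 (opNorm ((A + B * K) * psdSqrt (stateCov (A + B * K) N))) *
            (1 + Real.log N + Real.log n + Real.log (1 / δ)) ^ p}) ∧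
      -- the bound without the maximum, for a nonzero closed-loop matrix
      (A + B * K ≠ 0 → ENNReal.ofReal (1 - δ) ≤
        μ {ω | ‖martingaleTerm μ (discountRatio γ) (lqrState A B K W) (svec P) N ω‖ ≤
          C / min 1 (opNorm (A + B * K)) * ‖svec P‖ * √(N : ℝ) *
            ((stateCov (A + B * K) N).trace + discountRatio γ * √(n : ℝ)) *
            opNorm ((A + B * K) * psdSqrt (stateCov (A + B * K) N)) *
            (1 + Real.log N + Real.log n + Real.log (1 / δ)) ^ p}) := by
  refine ⟨2048, by norm_num, 4, ?_⟩
  intro n m N hn hN A B K Q R γ P δ _ _ hγ hγ1 _ _ hδ hδ1 Ω _ μ _ W hW hind hlaw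
  have hη : 0 ≤ discountRatio γ := div_nonneg hγ.le (by linarith)
  have hmain := le_measure_norm_martingaleTerm_le hn hN A B K P hη hδ hδ1 μ W hW hind hlaw
  refine ⟨hmain, fun hL => hmain.trans (measure_mono fun ω hω => ?_)⟩
  simp only [Set.mem_ofPred_eq] at hω ⊢
  refine hω.trans ?_
  have l1 := Real.log_nonneg (by exact_mod_cast hn : (1 : ℝ) ≤ n)
  have l2 := Real.log_nonneg (by exact_mod_cast hN : (1 : ℝ) ≤ N)
  have l3 := Real.log_nonneg (by rw [le_div_iff₀ hδ]; linarith : 1 ≤ 1 / δ)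
  have htr : 0 ≤ (stateCov (A + B * K) N).trace := (stateCov_posSemidef _ N).trace_nonneg
  calc _ ≤ 2048 * ‖svec P‖ * √(N : ℝ) *
        ((stateCov (A + B * K) N).trace + discountRatio γ * √(n : ℝ)) *
        (opNorm ((A + B * K) * psdSqrt (stateCov (A + B * K) N)) / min 1 (opNorm (A + B * K))) *
        (1 + Real.log N + Real.log n + Real.log (1 / δ)) ^ 4 := by
        have := max_one_opNorm_le hN hL
        gcongr
    _ = _ := by ring
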